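/- Let $E$ be a finite set of items and $O$ a finite set of states. The states of the items are independent: the state $Y_e$ of $e\in E$ has a given distribution $\mathcal D_e$ on $O$, so the realization $y=(y_e)_{e\in E}$ is drawn from $\prod_{e\in E}\mathcal D_e$. Let $\epsilon\in(0,1]$ and let $\mathcal F=\{f_1,\dots,f_m\}$, $m\ge 1$, be a family of reward functions $f_i:2^{E\times O}\to\mathbb R_{\ge 0}$, each of which is monotone ($f_i(A)\le f_i(B)$ for $A\subseteq B$) and $\epsilon$-nearly submodular, i.e. there is a submodular function $g_i:2^{E\times O}\to\mathbb R_{\ge0}$ (that is, $g_i(S_1\cup\{v\})-g_i(S_1)\ge g_i(S_2\cup\{v\})-g_i(S_2)$ whenever $S_1\subseteq S_2$ and $v\notin S_2$) such that $\epsilon\, g_i(X)\le f_i(X)\le \frac1\epsilon g_i(X)$ for all $X\subseteq E\times O$. An adaptive policy $\pi$ is a rule that, given the set of pairs (item, observed state) obtained so far, either names the next item to pick, whose state is then observed, or stops. For a realization $y$, let $E(\pi,y)\subseteq E$ be the set of items that $\pi$ picks under $y$ and $S(\pi,y)=\{(e,y_e):e\in E(\pi,y)\}$. Put $\mathcal U(\pi,f_i)=\mathbb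 E_y[f_i(S(\pi,y))]$ and $\mathcal U(\pi,\mathcal F)=\min_{1\le i\le m}\mathcal U(\pi,f_i)$. A (randomized) non-adaptive policy $\sigma$ picks a random set $V\subseteq E$ independent of the true realization $y$; put $\mathcal U(\sigma,f_i)=\mathbb E_V\,\mathbb E_y[f_i(\{(e,y_e):e\in V\})]$ and $\mathcal U(\sigma,\mathcal F)=\min_{1\le i\le m}\mathcal U(\sigma,f_i)$. For any adaptive policy $\pi$, let $\sigma_\pi$ be the non-adaptive policy that virtually draws a realization $y'$ from $\prod_{e\in E}\mathcal D_e$, independently of the true one, and picks exactly the set $E(\pi,y')$. Then $$\mathcal U(\sigma_\pi,\mathcal F)\ \ge\ \frac{\epsilon^2}{2}\,\mathcal U(\pi,\mathcal F).$$ Moreover, for every downward-closed family $\mathcal I$ of subsets of $E$, if $\pi$ is feasible (that is, $E(\pi,y)\in\mathcal I$ for every $y$), then every set that $\sigma_\pi$ picks with positive probability belongs to $\mathcal I$. -/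

import Mathlib

namespace ARONSS

/-- A set function on the subsets of a finite ground set `Ω` is submodular if it takes
non-negative values and has diminishing marginal returns. -/
structure IsSubmodular {Ω : Type*} [DecidableEq Ω] (h : Finset Ω → ℝ) : Prop where
  nonneg : ∀ S, 0 ≤ h S
  diminishing : ∀ S₁ S₂ : Finset Ω, S₁ ⊆ S₂ → ∀ v, v ∉ S₂ →
    h (insert v S₂) - h S₂ ≤ h (insert v S₁) - h S₁

/-- `f` is `ε`-nearly submodular: it is sandwiched between `ε • g` and `(1 / ε) • g` for some
submodular (not necessarily monotone) function `g`. -/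
def IsNearlySubmodular {Ω : Type*} [DecidableEq Ω] (ε : ℝ) (f : Finset Ω → ℝ) : Prop :=
  ∃ g : Finset Ω → ℝ, IsSubmodular g ∧ ∀ X, ε * g X ≤ f X ∧ f X ≤ (1 / ε) * g X

/-- The product distribution on realizations `y : E → O`: the states of the items are independent
and the state of `e` has distribution `D e`. -/
noncomputable def realization {E O : Type*} [Fintype E] [DecidableEq E] [Fintype O]
    (D : E → PMF O) : PMF (E → O) :=
  PMF.ofFintype (fun y => ∏ e, D e (y e)) (by
    rw [← Fintype.prod_sum]
    refine Finset.prod_eq_one fun e _ => ?_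
    rw [← tsum_fintype (L := SummationFilter.unconditional O)]
    exact (D e).tsum_coe)

/-- Expectation of a real function of the random realization. -/
noncomputable def expect {E O : Type*} [Fintype E] [DecidableEq E] [Fintype O]
    (D : E → PMF O) (F : (E → O) → ℝ) : ℝ :=
  ∑ y, (realization D y).toReal * F y

/-- An adaptive policy: given the set of observations (items and their states) made so far, it
names the next item to pick, or stops (`none`). -/
abbrev Policy (E O : Type*) := Finset (E × O) → Option E

/-- The observations of policy `π` after at most `k` steps, when the item states are `y`. -/
def observed {E O : Type*} [DecidableEq E] [DecidableEq O]
    (π : Policy E O) (y : E → O) : ℕ → Finset (E × O)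
  | 0 => ∅
  | k + 1 => (π (observed π y k)).elim (observed π y k)
      fun e => insert (e, y e) (observed π y k)

/-- The items and states `S(π, y)` finally picked by `π` under `y`. Every step that does not pick a
new item leaves the observations, hence all later ones, unchanged, so the run is complete
after `|E|` steps. -/
def outcome {E O : Type*} [Fintype E] [DecidableEq E] [DecidableEq O]
    (π : Policy E O) (y : E → O) : Finset (E × O) :=
  observed π y (Fintype.card E)

/-- The set of items `E(π, y)` picked by `π` under `y`. -/
def picked {E O : Type*} [Fintype E] [DecidableEq E] [DecidableEq O]
    (π : Policy E O) (y : E → O) : Finset E :=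
  (outcome π y).image Prod.fst

/-- Expected reward of an adaptive policy. -/
noncomputable def utility {E O : Type*} [Fintype E] [DecidableEq E] [Fintype O] [DecidableEq O]
    (D : E → PMF O) (π : Policy E O) (f : Finset (E × O) → ℝ) : ℝ :=
  expect D fun y => f (outcome π y)

/-- Worst-case expected reward of an adaptive policy over a finite family of reward functions. -/
noncomputable def robustUtility {E O ι : Type*} [Fintype E] [DecidableEq E] [Fintype O]
    [DecidableEq O] [Fintype ι] [Nonempty ι]
    (D : E → PMF O) (π : Policy E O) (f : ι → Finset (E × O) → ℝ) : ℝ :=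
  Finset.univ.inf' Finset.univ_nonempty fun i => utility D π (f i)

/-- Expected reward of a (randomized) non-adaptive policy `σ`, given as a distribution over the
sets of items: the set `V` is drawn from `σ` independently of the true states `y`. -/
noncomputable def nonadaptiveUtility {E O : Type*} [Fintype E] [DecidableEq E] [Fintype O]
    [DecidableEq O] (D : E → PMF O) (σ : PMF (Finset E)) (f : Finset (E × O) → ℝ) : ℝ :=
  ∑ V, (σ V).toReal * expect D fun y => f (V.image fun e => (e, y e))

/-- Worst-case expected reward of a non-adaptive policy over a finite family of reward
functions. -/
noncomputable def nonadaptiveRobustUtility {E O ι : Type*} [Fintype E] [DecidableEq E] [Fintype O]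
    [DecidableEq O] [Fintype ι] [Nonempty ι]
    (D : E → PMF O) (σ : PMF (Finset E)) (f : ι → Finset (E × O) → ℝ) : ℝ :=
  Finset.univ.inf' Finset.univ_nonempty fun i => nonadaptiveUtility D σ (f i)

/-- The non-adaptive policy `σ_π`: draw a virtual realization `y'` from the product distribution
and pick exactly the items that `π` picks under `y'`. -/
noncomputable def virtualPolicy {E O : Type*} [Fintype E] [DecidableEq E] [Fintype O]
    [DecidableEq O] (D : E → PMF O) (π : Policy E O) : PMF (Finset E) :=
  (realization D).map (picked π)

/-- `π` is feasible for the constraint family `I`. -/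
def Policy.Feasible {E O : Type*} [Fintype E] [DecidableEq E] [DecidableEq O]
    (π : Policy E O) (I : Set (Finset E)) : Prop :=
  ∀ y : E → O, picked π y ∈ I

/-- A non-adaptive policy is feasible if every set that it may pick is in `I`. -/
def NonadaptiveFeasible {E : Type*} (σ : PMF (Finset E)) (I : Set (Finset E)) : Prop :=
  ∀ V ∈ σ.support, V ∈ I

end ARONSS

/-!
The proof has two ingredients.

*Monotonization.* If `f` is monotone and `ε g ≤ f ≤ g / ε` with `g` submodular, then `g` may be
replaced by `h X = min {g Z | X ⊆ Z}`: this `h` is submodular (`IsSubmodular.upperMin`), monotone,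
and satisfies the same two bounds, since `f X ≤ f Z ≤ g Z / ε` for every `Z ⊇ X`.

*Random paths.* For monotone submodular `h`, let `y` and `z` be independent realizations, let `S k`
be the observations of `π` under `y` after `k` steps, and let `R k` be the same items with their
states read off from `z`. Then `𝔼 h (S k ∪ R k) ≤ 2 𝔼 h (R k)`, by induction on `k`
(`expect_observed_union_le`). Indeed, if the next item is `e`, the increase of the left side is by
submodularity at most the sum of the marginals of `(e, y e)` and of `(e, z e)` over `S k ∪ R k`.
These have the same mean, because exchanging the states of `e` in `y` and `z` preserves the law of
`(y, z)` and does not affect the first `k` steps (`expect_expect_swapNext`), and the second one is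
at most the marginal of `(e, z e)` over `R k`, which is the increase of `h (R k)`.

Now `𝔼 h (R |E|)` is the utility of the virtual policy for `h`, and the bounds between `f` and `h`
cost a factor `ε` each.
-/

namespace ARONSS

/-! ### Submodular functions and monotonization -/

section Submodular

variable {Ω : Type*} [DecidableEq Ω]

lemma IsSubmodular.union_sub_le {g : Finset Ω → ℝ} (hg : IsSubmodular g) {A B : Finset Ω}
    (hBA : B ⊆ A) (C : Finset Ω) (hC : Disjoint C A) :
    g (C ∪ A) - g A ≤ g (C ∪ B) - g B := by
  induction C using Finset.induction_on with
  | empty => simp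
  | insert v C hv ih =>
    rw [Finset.disjoint_insert_left] at hC
    have h1 := ih hC.2
    have h2 := hg.diminishing (C ∪ B) (C ∪ A) (Finset.union_subset_union_right hBA) v
      (by simp [hv, hC.1])
    rw [Finset.insert_union, Finset.insert_union]
    linarith

lemma IsSubmodular.union_add_inter_le {g : Finset Ω → ℝ} (hg : IsSubmodular g)
    (A B : Finset Ω) : g (A ∪ B) + g (A ∩ B) ≤ g A + g B := by
  have h := hg.union_sub_le (Finset.inter_subset_right : A ∩ B ⊆ B) (A \ B)
    Finset.sdiff_disjoint
  rw [Finset.sdiff_union_self_eq_union, Finset.sdiff_union_inter] at h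
  linarith

/-- For monotone functions, marginal returns also diminish when the new element is already in the
larger set. -/
lemma IsSubmodular.insert_sub_le {h : Finset Ω → ℝ} (hh : IsSubmodular h) (hm : Monotone h)
    {A B : Finset Ω} (hBA : B ⊆ A) (v : Ω) :
    h (insert v A) - h A ≤ h (insert v B) - h B := by
  by_cases hv : v ∈ A
  · have := hm (Finset.subset_insert v B)
    rw [Finset.insert_eq_of_mem hv]
    linarith
  · exact hh.diminishing B A hBA v hv

variable [Fintype Ω]

/-- The minimum of `g` over all supersets of `X`: the largest monotone function below `g`. -/
noncomputable def upperMin (g : Finset Ω → ℝ) (X : Finset Ω) : ℝ :=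
  (Finset.univ.filter (X ⊆ ·)).inf' ⟨Finset.univ, by simp⟩ g

lemma upperMin_le (g : Finset Ω → ℝ) {X Z : Finset Ω} (h : X ⊆ Z) : upperMin g X ≤ g Z :=
  Finset.inf'_le _ (by simpa using h)

lemma exists_upperMin_eq (g : Finset Ω → ℝ) (X : Finset Ω) : ∃ Z, X ⊆ Z ∧ upperMin g X = g Z := by
  obtain ⟨Z, hZ, h⟩ := Finset.exists_mem_eq_inf' (s := Finset.univ.filter (X ⊆ ·))
    ⟨Finset.univ, by simp⟩ g
  exact ⟨Z, by simpa using hZ, h⟩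

lemma upperMin_monotone (g : Finset Ω → ℝ) : Monotone (upperMin g) := by
  intro X Y hXY
  obtain ⟨Z, hZ, h⟩ := exists_upperMin_eq g Y
  rw [h]
  exact upperMin_le g (hXY.trans hZ)

lemma IsSubmodular.upperMin {g : Finset Ω → ℝ} (hg : IsSubmodular g) :
    IsSubmodular (upperMin g) where
  nonneg S := by
    obtain ⟨Z, -, h⟩ := exists_upperMin_eq g S
    exact h ▸ hg.nonneg Z
  diminishing S₁ S₂ h12 v _ := by
    obtain ⟨Z₁, hZ₁, e₁⟩ := exists_upperMin_eq g (insert v S₁)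
    obtain ⟨Z₂, hZ₂, e₂⟩ := exists_upperMin_eq g S₂
    rw [Finset.insert_subset_iff] at hZ₁
    have hu : ARONSS.upperMin g (insert v S₂) ≤ g (Z₁ ∪ Z₂) := upperMin_le g <|
      Finset.insert_subset (Finset.mem_union_left _ hZ₁.1) (hZ₂.trans Finset.subset_union_right)
    have hi : ARONSS.upperMin g S₁ ≤ g (Z₁ ∩ Z₂) :=
      upperMin_le g (Finset.subset_inter hZ₁.2 (h12.trans hZ₂))
    have := hg.union_add_inter_le Z₁ Z₂
    linarith

/-- The submodular function that witnesses near submodularity of a monotone function can be chosen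
monotone. -/
lemma IsNearlySubmodular.exists_monotone {ε : ℝ} (hε : 0 < ε) {f : Finset Ω → ℝ}
    (hf : Monotone f) (h : IsNearlySubmodular ε f) :
    ∃ g : Finset Ω → ℝ, IsSubmodular g ∧ Monotone g ∧
      ∀ X, ε * g X ≤ f X ∧ f X ≤ (1 / ε) * g X := by
  obtain ⟨g, hg, hgf⟩ := h
  refine ⟨upperMin g, hg.upperMin, upperMin_monotone g, fun X => ⟨?_, ?_⟩⟩
  · exact (mul_le_mul_of_nonneg_left (upperMin_le g subset_rfl) hε.le).trans (hgf X).1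
  · obtain ⟨Z, hZ, e⟩ := exists_upperMin_eq g X
    rw [e]
    exact (hf hZ).trans (hgf Z).2

end Submodular

/-! ### Runs of a policy and the exchange of the next state -/

section Runs

variable {E O : Type*} [DecidableEq E] [DecidableEq O]

/-- The first `k` steps depend only on the states of the items picked in them. -/
lemma observed_congr (π : Policy E O) {y z : E → O} (k : ℕ)
    (h : ∀ e ∈ (observed π y k).image Prod.fst, z e = y e) :
    observed π z k = observed π y k := by
  induction k with
  | zero => rfl
  | succ k ih =>
    cases hπ : π (observed π y k) with
    | none =>
      simp only [observed, hπ, Option.elim] at h ⊢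
      rw [ih h, hπ]
    | some e =>
      simp only [observed, hπ, Option.elim, Finset.image_insert, Finset.mem_insert,
        forall_eq_or_imp] at h ⊢
      rw [ih h.2, hπ, ← h.1]

lemma snd_eq_of_mem_observed (π : Policy E O) (y : E → O) (k : ℕ) {p : E × O}
    (hp : p ∈ observed π y k) : p.2 = y p.1 := by
  induction k with
  | zero => simp [observed] at hp
  | succ k ih =>
    cases hπ : π (observed π y k) with
    | none =>
      simp only [observed, hπ, Option.elim] at hp
      exact ih hp
    | some e =>
      simp only [observed, hπ, Option.elim, Finset.mem_insert] at hp
      rcases hp with rfl | hp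
      · rfl
      · exact ih hp

/-- The items that `π` picks under `y` in `k` steps, with their states read off from `z`. -/
def resampled (π : Policy E O) (y z : E → O) (k : ℕ) : Finset (E × O) :=
  (observed π y k).image fun p => (p.1, z p.1)

/-- The item that `π` names after `k` steps under `y`, provided that it has not been picked
before. -/
def nextItem (π : Policy E O) (y : E → O) (k : ℕ) : Option E :=
  (π (observed π y k)).filter fun e => e ∉ (observed π y k).image Prod.fst

lemma not_mem_of_nextItem_eq_some {π : Policy E O} {y : E → O} {k : ℕ} {e : E}
    (h : nextItem π y k = some e) : e ∉ (observed π y k).image Prod.fst := by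
  simpa using (Option.filter_eq_some_iff.1 h).2

lemma observed_succ_of_nextItem_eq_some {π : Policy E O} {y : E → O} {k : ℕ} {e : E}
    (h : nextItem π y k = some e) :
    observed π y (k + 1) = insert (e, y e) (observed π y k) := by
  simp [observed, (Option.filter_eq_some_iff.1 h).1]

lemma observed_succ_of_nextItem_eq_none {π : Policy E O} {y : E → O} {k : ℕ}
    (h : nextItem π y k = none) : observed π y (k + 1) = observed π y k := by
  cases hπ : π (observed π y k) with
  | none => simp [observed, hπ]
  | some e =>
    have he : e ∈ (observed π y k).image Prod.fst := by
      by_contra hne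
      rw [nextItem, hπ, Option.filter_some_pos (by simpa using hne)] at h
      exact Option.some_ne_none e h
    obtain ⟨p, hp, rfl⟩ := Finset.mem_image.1 he
    have h2 := snd_eq_of_mem_observed π y k hp
    simp only [observed, hπ, Option.elim]
    rw [← h2]
    exact Finset.insert_eq_of_mem hp

/-- Exchange, in a pair of realizations, the states of the item that `π` picks next after `k`
steps under the first one. -/
def swapNext (π : Policy E O) (k : ℕ) (p : (E → O) × (E → O)) : (E → O) × (E → O) :=
  (nextItem π p.1 k).elim p fun e =>
    (Function.update p.1 e (p.2 e), Function.update p.2 e (p.1 e))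

lemma observed_swapNext (π : Policy E O) (k : ℕ) (p : (E → O) × (E → O)) :
    observed π (swapNext π k p).1 k = observed π p.1 k := by
  cases h : nextItem π p.1 k with
  | none => simp [swapNext, h]
  | some e =>
    refine observed_congr π k fun e' he' => ?_
    have : e' ≠ e := by
      rintro rfl
      exact not_mem_of_nextItem_eq_some h he'
    simp [swapNext, h, this]

lemma nextItem_swapNext (π : Policy E O) (k : ℕ) (p : (E → O) × (E → O)) :
    nextItem π (swapNext π k p).1 k = nextItem π p.1 k := by
  simp only [nextItem, observed_swapNext]

lemma resampled_swapNext (π : Policy E O) (k : ℕ) (p : (E → O) × (E → O)) :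
    resampled π (swapNext π k p).1 (swapNext π k p).2 k = resampled π p.1 p.2 k := by
  rw [resampled, observed_swapNext, resampled]
  refine Finset.image_congr fun q hq => ?_
  cases h : nextItem π p.1 k with
  | none => simp [swapNext, h]
  | some e =>
    have : q.1 ≠ e := by
      rintro rfl
      exact not_mem_of_nextItem_eq_some h (Finset.mem_image_of_mem _ hq)
    simp [swapNext, h, this]

lemma swapNext_involutive (π : Policy E O) (k : ℕ) : Function.Involutive (swapNext π k) := by
  intro p
  have hn := nextItem_swapNext π k p
  rw [swapNext, hn]
  cases h : nextItem π p.1 k with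
  | none => simp [swapNext, h]
  | some e => simp [swapNext, h]

/-! ### Marginal returns along a run -/

/-- Marginal return over `observed π y k ∪ resampled π y z k` of the next item of `π`, with its
state read off from `x`; it is zero if there is no next item. -/
def nextMarginal (h : Finset (E × O) → ℝ) (π : Policy E O) (k : ℕ) (y z x : E → O) : ℝ :=
  (nextItem π y k).elim 0 fun e =>
    h (insert (e, x e) (observed π y k ∪ resampled π y z k)) -
      h (observed π y k ∪ resampled π y z k)

lemma observed_union_resampled_succ_le {h : Finset (E × O) → ℝ} (hh : IsSubmodular h)
    (hm : Monotone h) (π : Policy E O) (k : ℕ) (y z : E → O) :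
    h (observed π y (k + 1) ∪ resampled π y z (k + 1)) ≤
      h (observed π y k ∪ resampled π y z k) +
        (nextMarginal h π k y z y + nextMarginal h π k y z z) := by
  cases hn : nextItem π y k with
  | none => simp [nextMarginal, hn, resampled, observed_succ_of_nextItem_eq_none hn]
  | some e =>
    have := hh.insert_sub_le hm
      (Finset.subset_insert (e, z e) (observed π y k ∪ resampled π y z k)) (e, y e)
    simp only [resampled] at this
    simp only [nextMarginal, hn, resampled, observed_succ_of_nextItem_eq_some hn, Option.elim,
      Finset.image_insert, Finset.insert_union, Finset.union_insert]
    rw [Finset.insert_comm]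
    linarith

lemma nextMarginal_le_resampled {h : Finset (E × O) → ℝ} (hh : IsSubmodular h)
    (hm : Monotone h) (π : Policy E O) (k : ℕ) (y z : E → O) :
    h (resampled π y z k) + nextMarginal h π k y z z ≤ h (resampled π y z (k + 1)) := by
  cases hn : nextItem π y k with
  | none => simp [nextMarginal, hn, resampled, observed_succ_of_nextItem_eq_none hn]
  | some e =>
    have := hh.insert_sub_le hm
      (Finset.subset_union_right : resampled π y z k ⊆ observed π y k ∪ _) (e, z e)
    simp only [resampled] at this
    simp only [nextMarginal, hn, resampled, observed_succ_of_nextItem_eq_some hn, Option.elim,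
      Finset.image_insert]
    linarith

end Runs

section Policies

variable {E O : Type*} [Fintype E] [DecidableEq E] [Fintype O]

/-! ### Expectations -/

lemma realization_toReal (D : E → PMF O) (y : E → O) :
    (realization D y).toReal = ∏ e, (D e (y e)).toReal := by
  simp [realization, ENNReal.toReal_prod]

lemma expect_mono (D : E → PMF O) {F G : (E → O) → ℝ} (h : ∀ y, F y ≤ G y) :
    expect D F ≤ expect D G :=
  Finset.sum_le_sum fun y _ => mul_le_mul_of_nonneg_left (h y) ENNReal.toReal_nonneg

lemma expect_add (D : E → PMF O) (F G : (E → O) → ℝ) :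
    expect D (fun y => F y + G y) = expect D F + expect D G := by
  simp [expect, mul_add, Finset.sum_add_distrib]

lemma expect_const_mul (D : E → PMF O) (c : ℝ) (F : (E → O) → ℝ) :
    expect D (fun y => c * F y) = c * expect D F := by
  simp only [expect, Finset.mul_sum]
  exact Finset.sum_congr rfl fun y _ => by ring

lemma expect_const (D : E → PMF O) (c : ℝ) : expect D (fun _ => c) = c := by
  have h : ∑ y, (realization D y).toReal = 1 := by
    rw [← ENNReal.toReal_sum fun y _ => (realization D).apply_ne_top y,
      ← tsum_fintype (L := SummationFilter.unconditional _), (realization D).tsum_coe,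
      ENNReal.toReal_one]
  rw [expect, ← Finset.sum_mul, h, one_mul]

lemma expect_expect_eq_sum (D : E → PMF O) (F : (E → O) → (E → O) → ℝ) :
    expect D (fun y => expect D fun z => F y z) =
      ∑ p : (E → O) × (E → O),
        (realization D p.1).toReal * (realization D p.2).toReal * F p.1 p.2 := by
  simp only [expect, Finset.mul_sum, Fintype.sum_prod_type, mul_assoc]

variable [DecidableEq O]

/-- The utility of the virtual policy, as an expectation over the virtual realization `y` and the
true realization `z`. -/
lemma nonadaptiveUtility_virtualPolicy (D : E → PMF O) (π : Policy E O)
    (f : Finset (E × O) → ℝ) :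
    nonadaptiveUtility D (virtualPolicy D π) f =
      expect D fun y => expect D fun z => f ((picked π y).image fun e => (e, z e)) := by
  have h : ∀ V, (virtualPolicy D π V).toReal =
      ∑ y, if V = picked π y then (realization D y).toReal else 0 := by
    intro V
    rw [virtualPolicy, PMF.map_apply, tsum_fintype, ENNReal.toReal_sum]
    · exact Finset.sum_congr rfl fun y _ => by split_ifs <;> simp
    · intro y _
      split_ifs
      · exact (realization D).apply_ne_top y
      · simp
  simp only [nonadaptiveUtility, h, Finset.sum_mul, ite_mul, zero_mul]
  rw [Finset.sum_comm]
  simp [expect]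

/-! ### Exchangeability of the next state -/

lemma realization_mul_swapNext (D : E → PMF O) (π : Policy E O) (k : ℕ)
    (p : (E → O) × (E → O)) :
    (realization D (swapNext π k p).1).toReal * (realization D (swapNext π k p).2).toReal =
      (realization D p.1).toReal * (realization D p.2).toReal := by
  simp only [realization_toReal, ← Finset.prod_mul_distrib]
  refine Finset.prod_congr rfl fun e' _ => ?_
  cases h : nextItem π p.1 k with
  | none => simp [swapNext, h]
  | some e =>
    by_cases he : e' = e
    · subst he
      simp [swapNext, h, mul_comm]
    · simp [swapNext, h, he]

/-- The exchange preserves the law of a pair of independent realizations. -/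
lemma expect_expect_swapNext (D : E → PMF O) (π : Policy E O) (k : ℕ)
    (F : (E → O) → (E → O) → ℝ) :
    expect D (fun y => expect D fun z => F (swapNext π k (y, z)).1 (swapNext π k (y, z)).2) =
      expect D fun y => expect D fun z => F y z := by
  rw [expect_expect_eq_sum, expect_expect_eq_sum,
    ← Equiv.sum_comp (swapNext_involutive π k).toPerm]
  refine Finset.sum_congr rfl fun p _ => ?_
  rw [Function.Involutive.coe_toPerm, realization_mul_swapNext, Prod.mk.eta,
    swapNext_involutive π k p]

/-! ### The adaptivity gap for monotone submodular functions -/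

/-- The next item is as useful in its true state as in its resampled state, on average. -/
lemma expect_nextMarginal (D : E → PMF O) (h : Finset (E × O) → ℝ) (π : Policy E O) (k : ℕ) :
    expect D (fun y => expect D fun z => nextMarginal h π k y z y) =
      expect D fun y => expect D fun z => nextMarginal h π k y z z := by
  rw [← expect_expect_swapNext D π k fun y z => nextMarginal h π k y z z]
  congr! 4 with y z
  have h1 := nextItem_swapNext π k (y, z)
  have h2 := observed_swapNext π k (y, z)
  have h3 := resampled_swapNext π k (y, z)
  simp only at h1 h2 h3
  simp only [nextMarginal, h1, h2, h3]
  cases hn : nextItem π y k with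
  | none => rfl
  | some e => simp [swapNext, hn]

lemma expect_observed_union_le (D : E → PMF O) {h : Finset (E × O) → ℝ} (hh : IsSubmodular h)
    (hm : Monotone h) (π : Policy E O) (k : ℕ) :
    expect D (fun y => expect D fun z => h (observed π y k ∪ resampled π y z k)) ≤
      2 * expect D fun y => expect D fun z => h (resampled π y z k) := by
  induction k with
  | zero =>
    simp only [observed, resampled, Finset.image_empty, Finset.union_empty, expect_const]
    linarith [hh.nonneg ∅]
  | succ k ih =>
    have h1 := expect_mono D fun y => expect_mono D fun z =>
      observed_union_resampled_succ_le hh hm π k y z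
    have h2 := expect_mono D fun y => expect_mono D fun z =>
      nextMarginal_le_resampled hh hm π k y z
    simp only [expect_add] at h1 h2
    rw [expect_nextMarginal] at h1
    linarith

/-- The adaptivity gap of the virtual policy is at most `2` for monotone submodular rewards. -/
lemma utility_le_two_mul_of_isSubmodular (D : E → PMF O) {h : Finset (E × O) → ℝ}
    (hh : IsSubmodular h) (hm : Monotone h) (π : Policy E O) :
    utility D π h ≤ 2 * nonadaptiveUtility D (virtualPolicy D π) h := by
  have h1 := expect_observed_union_le D hh hm π (Fintype.card E)
  have h2 : utility D π h ≤ expect D fun y => expect D fun z =>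
      h (observed π y (Fintype.card E) ∪ resampled π y z (Fintype.card E)) := by
    refine expect_mono D fun y => ?_
    rw [← expect_const D (h (outcome π y))]
    exact expect_mono D fun z => hm Finset.subset_union_left
  rw [nonadaptiveUtility_virtualPolicy]
  simp only [picked, outcome, Finset.image_image]
  exact h2.trans h1

/-! ### Nearly submodular rewards -/

lemma utility_le_of_isNearlySubmodular (D : E → PMF O) {ε : ℝ} (hε : 0 < ε)
    {f : Finset (E × O) → ℝ} (hf : Monotone f) (hn : IsNearlySubmodular ε f)
    (π : Policy E O) :
    ε ^ 2 / 2 * utility D π f ≤ nonadaptiveUtility D (virtualPolicy D π) f := by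
  obtain ⟨h, hh, hm, hfh⟩ := hn.exists_monotone hε hf
  have h1 : utility D π f ≤ (1 / ε) * utility D π h := by
    rw [utility, utility, ← expect_const_mul]
    exact expect_mono D fun y => (hfh _).2
  have h2 : ε * nonadaptiveUtility D (virtualPolicy D π) h ≤
      nonadaptiveUtility D (virtualPolicy D π) f := by
    simp only [nonadaptiveUtility_virtualPolicy, ← expect_const_mul]
    exact expect_mono D fun y => expect_mono D fun z => (hfh _).1
  calc ε ^ 2 / 2 * utility D π f ≤ ε ^ 2 / 2 * ((1 / ε) * utility D π h) := by gcongr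
    _ = ε / 2 * utility D π h := by field_simp
    _ ≤ ε / 2 * (2 * nonadaptiveUtility D (virtualPolicy D π) h) := by
      gcongr
      exact utility_le_two_mul_of_isSubmodular D hh hm π
    _ = ε * nonadaptiveUtility D (virtualPolicy D π) h := by ring
    _ ≤ _ := h2

lemma Policy.Feasible.virtualPolicy {π : Policy E O} {I : Set (Finset E)} (hπ : π.Feasible I)
    (D : E → PMF O) : NonadaptiveFeasible (virtualPolicy D π) I := by
  intro V hV
  rw [ARONSS.virtualPolicy, PMF.support_map] at hV
  obtain ⟨y, -, rfl⟩ := hV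
  exact hπ y

end Policies

end ARONSS

theorem theorem1 {E O ι : Type*} [Fintype E] [DecidableEq E] [Fintype O] [DecidableEq O]
    [Fintype ι] [Nonempty ι]
    (D : E → PMF O) (ε : ℝ) (hε₀ : 0 < ε) (hε₁ : ε ≤ 1)
    (f : ι → Finset (E × O) → ℝ)
    (hnonneg : ∀ i X, 0 ≤ f i X)
    (hmono : ∀ i, Monotone (f i))
    (hnear : ∀ i, ARONSS.IsNearlySubmodular ε (f i))
    (π : ARONSS.Policy E O) :
    ε ^ 2 / 2 * ARONSS.robustUtility D π f ≤
        ARONSS.nonadaptiveRobustUtility D (ARONSS.virtualPolicy D π) f ∧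
      ∀ I : Set (Finset E), IsLowerSet I → ARONSS.Policy.Feasible π I →
        ARONSS.NonadaptiveFeasible (ARONSS.virtualPolicy D π) I := by
  refine ⟨Finset.le_inf' _ _ fun i _ => ?_, fun I _ hπ => hπ.virtualPolicy D⟩
  refine le_trans ?_ (ARONSS.utility_le_of_isNearlySubmodular D hε₀ (hmono i) (hnear i) π)
  gcongr
  exact Finset.inf'_le _ (Finset.mem_univ i)
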